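/- For a nonnegative Borel measure $\mu$ on $\mathbb R^n$ and $0<\beta<n$ let $\mathbf I_{\beta}\mu(x)=\int_{\mathbb R^n}|x-y|^{\beta-n}\,d\mu(y)\in[0,\infty]$ be its Riesz potential. Let $0<q<1$, $0<\alpha<\frac n2$, $0<r<\infty$, and let $\sigma\not\equiv0$ be a nonnegative Radon measure on $\mathbb R^n$. A function $u:\mathbb R^n\to[0,\infty]$ with $u\in L^q_{\rm loc}(\mathbb R^n,d\sigma)$ is called a solution of $(-\Delta)^\alpha u=\sigma u^q$ in $\mathbb R^n$ if $u=\mathbf I_{2\alpha}(u^q\,d\sigma)$ everywhere in $\mathbb R^n$, and a supersolution if $u\ge\mathbf I_{2\alpha}(u^q\,d\sigma)$ everywhere in $\mathbb R^n$. (i) Suppose that $r>\frac{n}{n-2\alpha}$ and $\mathbf I_{2\alpha}\sigma\in L^{\frac{\gamma+q}{1-q}}(\mathbb R^n,d\sigma)$, where $\gamma=\frac{r(n-2\alpha)-n}{n}$. Then there exists a solution $u\in L^r(\mathbb R^n)$ that is positive everywhere in $\mathbb{R}^n$; moreover $\liminf_{x\to\infty}u(x)=0$. (ii) If $0<r\le\frac{n}{n-2\alpha}$,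 then there are only trivial supersolutions in $L^r(\mathbb R^n)$: every supersolution $u\in L^r(\mathbb R^n)$ vanishes $\sigma$-almost everywhere (that is, $u^q\,d\sigma=0$). If moreover $u$ is a solution, or more generally if $u\in L^r(\mathbb{R}^n)\cap L^q_{\rm loc}(\mathbb{R}^n,d\sigma)$ and $u=\mathbf I_{2\alpha}\omega$ everywhere for some Radon measure $\omega\ge u^q\,d\sigma$, then $u=0$ everywhere in $\mathbb R^n$. -/

import Mathlib

open MeasureTheory Filter
open scoped ENNReal

noncomputable section

/-- The Riesz potential `I_β μ (x) = ∫ |x - y|^(β - n) dμ(y)` of order `β` of a measure on `ℝⁿ`,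
with values in `[0, ∞]`; for `β < n` the kernel is `+∞` on the diagonal. -/
def rieszPotential {n : ℕ} (β : ℝ) (μ : Measure (EuclideanSpace ℝ (Fin n)))
    (x : EuclideanSpace ℝ (Fin n)) : ℝ≥0∞ :=
  ∫⁻ y, edist x y ^ (β - n) ∂μ

/-- The measure `u^q dσ`. -/
def powMeasure {n : ℕ} (u : EuclideanSpace ℝ (Fin n) → ℝ≥0∞) (q : ℝ)
    (σ : Measure (EuclideanSpace ℝ (Fin n))) : Measure (EuclideanSpace ℝ (Fin n)) :=
  σ.withDensity (fun y => u y ^ q)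

/-- `u ∈ L^q_loc(ℝⁿ, dσ)`: `u` is in `L^q(K, dσ)` for every compact set `K`. -/
def MemLpLoc {n : ℕ} (u : EuclideanSpace ℝ (Fin n) → ℝ≥0∞) (q : ℝ)
    (σ : Measure (EuclideanSpace ℝ (Fin n))) : Prop :=
  ∀ K : Set (EuclideanSpace ℝ (Fin n)), IsCompact K →
    MemLp u (ENNReal.ofReal q) (σ.restrict K)

/-- `u ≥ 0` solves `(-Δ)^α u = σ u^q` in `ℝⁿ`, understood as the integral equation
`u = I_{2α}(u^q dσ)` at every point, with `u ∈ L^q_loc(dσ)`. -/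
structure IsSolution {n : ℕ} (α q : ℝ) (σ : Measure (EuclideanSpace ℝ (Fin n)))
    (u : EuclideanSpace ℝ (Fin n) → ℝ≥0∞) : Prop where
  memLpLoc : MemLpLoc u q σ
  eq_potential : ∀ x, u x = rieszPotential (2 * α) (powMeasure u q σ) x

/-- `u ≥ 0` is a supersolution of the integral equation: `u ≥ I_{2α}(u^q dσ)` at every point,
with `u ∈ L^q_loc(dσ)`. -/
structure IsSupersolution {n : ℕ} (α q : ℝ) (σ : Measure (EuclideanSpace ℝ (Fin n)))
    (u : EuclideanSpace ℝ (Fin n) → ℝ≥0∞) : Prop where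
  memLpLoc : MemLpLoc u q σ
  potential_le : ∀ x, rieszPotential (2 * α) (powMeasure u q σ) x ≤ u x

/-- `u ≥ 0` satisfies `(-Δ)^α u ≥ σ u^q` in `ℝⁿ`, in the sense that `u ∈ L^q_loc(dσ)` and
`u = I_{2α} ω` for some Radon measure `ω ≥ u^q dσ`. -/
structure IsPotentialSupersolution {n : ℕ} (α q : ℝ) (σ : Measure (EuclideanSpace ℝ (Fin n)))
    (u : EuclideanSpace ℝ (Fin n) → ℝ≥0∞) : Prop where
  memLpLoc : MemLpLoc u q σ
  exists_measure : ∃ ω : Measure (EuclideanSpace ℝ (Fin n)), IsLocallyFiniteMeasure ω ∧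
    powMeasure u q σ ≤ ω ∧ ∀ x, u x = rieszPotential (2 * α) ω x

end

/-!
(i) Let `T u = I_{2α}(u^q dσ)`. By the weak maximum principle for Riesz potentials, a small multiple
of `(I_{2α} σ)^{1/(1-q)}` is a positive subsolution `u₀ ≤ T u₀`, so the iterates of `T` increase to
a solution. They stay bounded in `L^{γ+q}(σ)` because of the norm inequality
`‖T f‖_{L^s(σ)} ≤ C ‖f‖_{L^s(σ)}^q`, `s = γ + q`: the Besicovitch covering theorem gives a weak type
`(1, 1)` bound for `g ↦ I(g dσ) / Iσ`, interpolation with `L^∞` makes this operator bounded on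
`L^{s/q}(σ)`, and Hölder's inequality trades the weight `Iσ` for the hypothesis on `Iσ`.
Finally `∫ u^γ dμ < ∞` for `μ = u^q dσ`, `u = Iμ`, and this energy controls `∫ u^r dx`: the set
`{u > Ct}` only depends on the part of `μ` on `{u > t}`, whose potential satisfies the weak type
`(1, n/(n-2α))` estimate.

(ii) A nonzero potential `I_{2α} ω` decays no faster than `|x|^{2α-n}` at infinity, and
`|x|^{(2α-n)r}` is not integrable at infinity when `(n - 2α) r ≤ n`.
-/

section LayerCake

variable {X Y : Type*} [MeasurableSpace X] [MeasurableSpace Y] {a : ℝ}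

theorem setLIntegral_Ioc_mul_rpow_sub_one (ha : 0 < a) {T : ℝ} (hT : 0 ≤ T) :
    ∫⁻ t in Set.Ioc 0 T, ENNReal.ofReal (a * t ^ (a - 1)) = ENNReal.ofReal (T ^ a) := by
  have hint : IntervalIntegrable (fun t : ℝ => a * t ^ (a - 1)) volume 0 T :=
    (intervalIntegral.intervalIntegrable_rpow' (by linarith)).const_mul a
  rw [← ofReal_integral_eq_lintegral_ofReal, ← intervalIntegral.integral_of_le hT,
    intervalIntegral.integral_const_mul, integral_rpow (Or.inl (by linarith)), sub_add_cancel,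
    Real.zero_rpow ha.ne', sub_zero, mul_div_cancel₀ _ ha.ne']
  · exact (intervalIntegrable_iff_integrableOn_Ioc_of_le hT).1 hint
  · filter_upwards [ae_restrict_mem measurableSet_Ioc] with t ht
    have := Real.rpow_nonneg ht.1.le (a - 1)
    positivity

theorem setLIntegral_Ioi_mul_rpow_sub_one (ha : 0 < a) :
    ∫⁻ t in Set.Ioi 0, ENNReal.ofReal (a * t ^ (a - 1)) = ∞ := by
  refine ENNReal.eq_top_of_forall_nnreal_le fun M => ?_
  calc (M : ℝ≥0∞) = ENNReal.ofReal (((M : ℝ) ^ a⁻¹) ^ a) := by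
        rw [Real.rpow_inv_rpow M.coe_nonneg ha.ne', ENNReal.ofReal_coe_nnreal]
    _ = ∫⁻ t in Set.Ioc 0 ((M : ℝ) ^ a⁻¹), ENNReal.ofReal (a * t ^ (a - 1)) :=
        (setLIntegral_Ioc_mul_rpow_sub_one ha (by positivity)).symm
    _ ≤ _ := lintegral_mono_set Set.Ioc_subset_Ioi_self

theorem rpow_eq_setLIntegral_ofReal_lt (ha : 0 < a) (c : ℝ≥0∞) :
    c ^ a = ∫⁻ t in {t | ENNReal.ofReal t < c} ∩ Set.Ioi 0, ENNReal.ofReal (a * t ^ (a - 1)) := by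
  by_cases hc : c = ∞
  · simp [hc, ENNReal.top_rpow_of_pos ha, setLIntegral_Ioi_mul_rpow_sub_one ha]
  have hset : {t | ENNReal.ofReal t < c} ∩ Set.Ioi 0 = Set.Ioo 0 c.toReal := by
    ext t
    refine ⟨fun ⟨htc, ht⟩ => ⟨ht, ?_⟩, fun ⟨ht, htc⟩ => ⟨?_, ht⟩⟩
    · exact (ENNReal.ofReal_lt_iff_lt_toReal (Set.mem_Ioi.1 ht).le hc).1 htc
    · exact (ENNReal.ofReal_lt_iff_lt_toReal ht.le hc).2 htc
  rw [hset, setLIntegral_congr Ioo_ae_eq_Ioc,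
    setLIntegral_Ioc_mul_rpow_sub_one ha ENNReal.toReal_nonneg,
    ← ENNReal.ofReal_rpow_of_nonneg ENNReal.toReal_nonneg ha.le, ENNReal.ofReal_toReal hc]

theorem lintegral_rpow_eq_lintegral_meas_ofReal_lt {μ : Measure X} [SFinite μ] {f : X → ℝ≥0∞}
    (hf : Measurable f) (ha : 0 < a) :
    ∫⁻ x, f x ^ a ∂μ = ∫⁻ t in Set.Ioi 0,
      ENNReal.ofReal (a * t ^ (a - 1)) * μ {x | ENNReal.ofReal t < f x} := by
  have hset : MeasurableSet {z : X × ℝ | ENNReal.ofReal z.2 < f z.1} :=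
    measurableSet_lt (by fun_prop) (by fun_prop)
  calc ∫⁻ x, f x ^ a ∂μ
      = ∫⁻ x, (∫⁻ t in Set.Ioi 0, {t | ENNReal.ofReal t < f x}.indicator
          (fun t => ENNReal.ofReal (a * t ^ (a - 1))) t) ∂μ := by
        refine lintegral_congr fun x => ?_
        rw [rpow_eq_setLIntegral_ofReal_lt ha, setLIntegral_indicator]
        exact measurableSet_lt (by fun_prop) measurable_const
    _ = ∫⁻ t in Set.Ioi 0, ∫⁻ x, {x | ENNReal.ofReal t < f x}.indicator
          (fun _ => ENNReal.ofReal (a * t ^ (a - 1))) x ∂μ := by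
        rw [lintegral_lintegral_swap]
        · rfl
        · exact ((show Measurable fun z : X × ℝ => ENNReal.ofReal (a * z.2 ^ (a - 1)) by
            fun_prop).indicator hset).aemeasurable
    _ = _ := lintegral_congr fun t =>
        lintegral_indicator_const (measurableSet_lt measurable_const hf) _

theorem rpow_mul_meas_lt_le_lintegral (μ : Measure X) {g : X → ℝ≥0∞} (hg : Measurable g)
    (ha : 0 ≤ a) (t : ℝ≥0∞) : t ^ a * μ {x | t < g x} ≤ ∫⁻ x, g x ^ a ∂μ :=
  calc t ^ a * μ {x | t < g x} ≤ t ^ a * μ {x | t ^ a ≤ g x ^ a} := by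
        gcongr with x
        exact fun h => ENNReal.rpow_le_rpow h.le ha
    _ ≤ _ := mul_meas_ge_le_lintegral (hg.pow_const a) _

theorem rpow_sub_one_mul_div_rpow {p γ : ℝ} (hp : 1 ≤ p) {t : ℝ≥0∞} (ht0 : t ≠ 0) (ht : t ≠ ∞)
    (m : ℝ≥0∞) :
    t ^ ((1 + γ) * p - 1) * (m / t) ^ p = (t ^ γ * m) ^ (p - 1) * (t ^ (γ - 1) * m) := by
  have hm : m ^ p = m ^ (p - 1) * m := by
    conv_lhs => rw [← sub_add_cancel p 1,
      ENNReal.rpow_add_of_nonneg _ _ (by linarith) zero_le_one, ENNReal.rpow_one]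
  have ht_pow : t ^ ((1 + γ) * p - 1) * t ^ (-p) = t ^ (γ * (p - 1)) * t ^ (γ - 1) := by
    rw [← ENNReal.rpow_add _ _ ht0 ht, ← ENNReal.rpow_add _ _ ht0 ht]
    ring_nf
  rw [ENNReal.div_rpow_of_nonneg _ _ (by linarith), div_eq_mul_inv, ← ENNReal.rpow_neg,
    ENNReal.mul_rpow_of_nonneg _ _ (by linarith), ← ENNReal.rpow_mul, hm]
  calc _ = t ^ ((1 + γ) * p - 1) * t ^ (-p) * (m ^ (p - 1) * m) := by ring
    _ = t ^ (γ * (p - 1)) * t ^ (γ - 1) * (m ^ (p - 1) * m) := by rw [ht_pow]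
    _ = _ := by ring

theorem ofReal_mul_rpow_mul_le_of_le_mul_div_rpow {p γ : ℝ} (hp : 1 ≤ p) (hγ : 0 < γ) {t : ℝ}
    (ht : 0 < t) {A E m N : ℝ≥0∞} (hN : N ≤ A * (m / ENNReal.ofReal t) ^ p)
    (hm : ENNReal.ofReal t ^ γ * m ≤ E) :
    ENNReal.ofReal ((1 + γ) * p * t ^ ((1 + γ) * p - 1)) * N ≤
      A * ENNReal.ofReal ((1 + γ) * p / γ) * E ^ (p - 1) *
        (ENNReal.ofReal (γ * t ^ (γ - 1)) * m) := by
  have hr_pow : ENNReal.ofReal ((1 + γ) * p * t ^ ((1 + γ) * p - 1)) =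
      ENNReal.ofReal ((1 + γ) * p) * ENNReal.ofReal t ^ ((1 + γ) * p - 1) := by
    rw [ENNReal.ofReal_mul (by positivity), ENNReal.ofReal_rpow_of_pos ht]
  have hγ_pow : ENNReal.ofReal ((1 + γ) * p) * ENNReal.ofReal t ^ (γ - 1) =
      ENNReal.ofReal ((1 + γ) * p / γ) * ENNReal.ofReal (γ * t ^ (γ - 1)) := by
    rw [ENNReal.ofReal_rpow_of_pos ht, ← ENNReal.ofReal_mul (by positivity),
      ← ENNReal.ofReal_mul (by positivity), ← mul_assoc, div_mul_cancel₀ _ hγ.ne']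
  have hT0 : ENNReal.ofReal t ≠ 0 := by simpa using ht
  set r := (1 + γ) * p
  set T := ENNReal.ofReal t
  calc ENNReal.ofReal (r * t ^ (r - 1)) * N
      ≤ ENNReal.ofReal r * T ^ (r - 1) * (A * (m / T) ^ p) := by rw [hr_pow]; gcongr
    _ = A * ENNReal.ofReal r * ((T ^ γ * m) ^ (p - 1) * (T ^ (γ - 1) * m)) := by
        rw [← rpow_sub_one_mul_div_rpow hp hT0 ENNReal.ofReal_ne_top]
        ring
    _ ≤ A * ENNReal.ofReal r * (E ^ (p - 1) * (T ^ (γ - 1) * m)) := by gcongr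
    _ = A * E ^ (p - 1) * (ENNReal.ofReal r * T ^ (γ - 1)) * m := by ring
    _ = _ := by rw [hγ_pow]; ring

/-- The distribution function enters the hypothesis with the power `p`; Markov's inequality turns
all but one of these powers into the integral of `g ^ γ`, which leaves a layer cake formula. -/
theorem lintegral_rpow_le_of_meas_lt_le {μ : Measure X} {ν : Measure Y} [SFinite μ] [SFinite ν]
    {f : Y → ℝ≥0∞} {g : X → ℝ≥0∞} (hf : Measurable f) (hg : Measurable g) {p γ : ℝ} (hp : 1 ≤ p)
    (hγ : 0 < γ) {A : ℝ≥0∞}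
    (h : ∀ t, t ≠ 0 → t ≠ ∞ → ν {y | t < f y} ≤ A * (μ {x | t < g x} / t) ^ p) :
    ∫⁻ y, f y ^ ((1 + γ) * p) ∂ν ≤
      A * ENNReal.ofReal ((1 + γ) * p / γ) * (∫⁻ x, g x ^ γ ∂μ) ^ p := by
  set r := (1 + γ) * p
  set E := ∫⁻ x, g x ^ γ ∂μ with hE
  have hr0 : 0 < r := by positivity
  have hmeas : Measurable fun t : ℝ =>
      ENNReal.ofReal (γ * t ^ (γ - 1)) * μ {x | ENNReal.ofReal t < g x} :=
    Measurable.mul (by fun_prop) <| Antitone.measurable fun s t hst =>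
      measure_mono fun x hx => (ENNReal.ofReal_le_ofReal hst).trans_lt hx
  have hlevel : ∀ t ∈ Set.Ioi (0 : ℝ),
      ENNReal.ofReal (r * t ^ (r - 1)) * ν {y | ENNReal.ofReal t < f y} ≤
        A * ENNReal.ofReal (r / γ) * E ^ (p - 1) *
          (ENNReal.ofReal (γ * t ^ (γ - 1)) * μ {x | ENNReal.ofReal t < g x}) := fun t ht =>
    ofReal_mul_rpow_mul_le_of_le_mul_div_rpow hp hγ ht
      (h _ (by simpa using ht) ENNReal.ofReal_ne_top)
      (rpow_mul_meas_lt_le_lintegral μ hg hγ.le _)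
  rw [lintegral_rpow_eq_lintegral_meas_ofReal_lt hf hr0]
  refine (setLIntegral_mono' measurableSet_Ioi hlevel).trans_eq ?_
  rw [lintegral_const_mul _ hmeas, ← lintegral_rpow_eq_lintegral_meas_ofReal_lt hg hγ, mul_assoc,
    ← hE]
  congr 1
  conv_rhs => rw [← sub_add_cancel p 1,
    ENNReal.rpow_add_of_nonneg _ _ (by linarith) zero_le_one, ENNReal.rpow_one]

end LayerCake

section Potential

variable {n : ℕ} {β : ℝ} {μ ν : Measure (EuclideanSpace ℝ (Fin n))}

theorem antitone_ennreal_rpow_of_nonpos {z : ℝ} (hz : z ≤ 0) :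
    Antitone fun a : ℝ≥0∞ => a ^ z := fun a b hab => by
  dsimp only
  rw [← neg_neg z, ENNReal.rpow_neg, ENNReal.rpow_neg a]
  exact ENNReal.inv_le_inv.2 (ENNReal.rpow_le_rpow hab (by linarith))

theorem measurable_rieszPotential (β : ℝ) (μ : Measure (EuclideanSpace ℝ (Fin n))) [SFinite μ] :
    Measurable (rieszPotential β μ) :=
  Measurable.lintegral_prod_right' (ν := μ)
    (f := fun z : EuclideanSpace ℝ (Fin n) × EuclideanSpace ℝ (Fin n) =>
      edist z.1 z.2 ^ (β - n)) (by fun_prop)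

theorem rieszPotential_mono (h : μ ≤ ν) : rieszPotential β μ ≤ rieszPotential β ν :=
  fun _ => lintegral_mono' h le_rfl

theorem rieszPotential_zero : rieszPotential β (0 : Measure (EuclideanSpace ℝ (Fin n))) = 0 :=
  funext fun _ => lintegral_zero_measure _

theorem rieszPotential_ne_zero (hβ : β ≤ n) (hμ : μ ≠ 0) (x : EuclideanSpace ℝ (Fin n)) :
    rieszPotential β μ x ≠ 0 := by
  intro h
  rw [rieszPotential, lintegral_eq_zero_iff (by fun_prop)] at h
  refine hμ (Measure.measure_univ_eq_zero.1 (measure_mono_null (fun y _ => ?_) (ae_iff.1 h)))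
  simp [ENNReal.rpow_eq_zero_iff, hβ]

theorem rieszPotential_smul (c : ℝ≥0∞) (x : EuclideanSpace ℝ (Fin n)) :
    rieszPotential β (c • μ) x = c * rieszPotential β μ x := lintegral_smul_measure _ _

theorem rieszPotential_withDensity {g : EuclideanSpace ℝ (Fin n) → ℝ≥0∞} (hg : Measurable g)
    (x : EuclideanSpace ℝ (Fin n)) :
    rieszPotential β (μ.withDensity g) x = ∫⁻ y, g y * edist x y ^ (β - n) ∂μ :=
  lintegral_withDensity_eq_lintegral_mul _ hg (by fun_prop)

theorem rieszPotential_restrict_add_compl {s : Set (EuclideanSpace ℝ (Fin n))}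
    (hs : MeasurableSet s) (x : EuclideanSpace ℝ (Fin n)) :
    rieszPotential β (μ.restrict s) x + rieszPotential β (μ.restrict sᶜ) x =
      rieszPotential β μ x := lintegral_add_compl _ hs

theorem lintegral_rieszPotential_comm [SFinite μ] [SFinite ν] :
    ∫⁻ x, rieszPotential β μ x ∂ν = ∫⁻ y, rieszPotential β ν y ∂μ := by
  simp only [rieszPotential]
  rw [lintegral_lintegral_swap (by fun_prop)]
  simp_rw [edist_comm]

theorem isClosed_rieszPotential_le (t : ℝ≥0∞) : IsClosed {x | rieszPotential β μ x ≤ t} := by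
  refine isSeqClosed_iff_isClosed.1 fun a x ha hx => ?_
  have hlim : ∀ y, Tendsto (fun k => edist (a k) y ^ (β - n)) atTop (nhds (edist x y ^ (β - n))) :=
    fun y => (ENNReal.continuous_rpow_const.tendsto _).comp (hx.edist tendsto_const_nhds)
  calc rieszPotential β μ x = ∫⁻ y, liminf (fun k => edist (a k) y ^ (β - n)) atTop ∂μ :=
        lintegral_congr fun y => (hlim y).liminf_eq.symm
    _ ≤ liminf (fun k => rieszPotential β μ (a k)) atTop :=
        lintegral_liminf_le fun k => by fun_prop
    _ ≤ liminf (fun _ : ℕ => t) atTop := liminf_le_liminf (Eventually.of_forall ha)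
    _ = t := liminf_const t

theorem isOpen_lt_rieszPotential (t : ℝ≥0∞) : IsOpen {x | t < rieszPotential β μ x} := by
  simpa only [Set.compl_ofPred, not_le] using
    (isClosed_rieszPotential_le (β := β) (μ := μ) t).isOpen_compl

/-- Weak maximum principle: a point `z` of the closed set nearest to `x` satisfies
`|z - y| ≤ 2 |x - y|` for every `y` in the set. -/
theorem rieszPotential_restrict_le (hβ : β ≤ n) (t : ℝ≥0∞) (x : EuclideanSpace ℝ (Fin n)) :
    rieszPotential β (μ.restrict {y | rieszPotential β μ y ≤ t}) x ≤ 2 ^ (n - β) * t := by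
  set F := {y | rieszPotential β μ y ≤ t}
  have hFc : IsClosed F := isClosed_rieszPotential_le t
  rcases F.eq_empty_or_nonempty with hempty | hne
  · simp [hempty, rieszPotential_zero]
  obtain ⟨z, hzF, hz⟩ := hFc.exists_infDist_eq_dist hne x
  have hdist : ∀ y ∈ F, edist z y ≤ 2 * edist x y := by
    intro y hy
    have hxz : edist x z ≤ edist x y := by
      rw [edist_dist, edist_dist, ← hz]
      exact ENNReal.ofReal_le_ofReal (Metric.infDist_le_dist_of_mem hy)
    calc edist z y ≤ edist x z + edist x y := edist_triangle_left _ _ _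
      _ ≤ _ := by rw [two_mul]; gcongr
  have hkernel : ∀ y ∈ F, edist x y ^ (β - n) ≤ 2 ^ (n - β) * edist z y ^ (β - n) := fun y hy =>
    calc edist x y ^ (β - n) = 2 ^ (n - β) * (2 * edist x y) ^ (β - n) := by
          rw [ENNReal.mul_rpow_of_ne_top (by norm_num) (edist_ne_top _ _), ← mul_assoc,
            ← ENNReal.rpow_add _ _ (by norm_num) (by norm_num)]
          simp
      _ ≤ _ := mul_le_mul_right (antitone_ennreal_rpow_of_nonpos (sub_nonpos.2 hβ) (hdist y hy)) _
  calc rieszPotential β (μ.restrict F) x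
      ≤ ∫⁻ y in F, 2 ^ (n - β) * edist z y ^ (β - n) ∂μ :=
        setLIntegral_mono' hFc.measurableSet hkernel
    _ = 2 ^ (n - β) * rieszPotential β (μ.restrict F) z := lintegral_const_mul _ (by fun_prop)
    _ ≤ 2 ^ (n - β) * rieszPotential β μ z := by
        gcongr; exact rieszPotential_mono Measure.restrict_le_self z
    _ ≤ 2 ^ (n - β) * t := by gcongr; exact hzF

theorem lt_rieszPotential_restrict (hβ : β ≤ n) {t : ℝ≥0∞} {x : EuclideanSpace ℝ (Fin n)}
    (hx : t < rieszPotential β μ x / (2 * 2 ^ (n - β))) :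
    t < rieszPotential β (μ.restrict {y | t < rieszPotential β μ y}) x := by
  set k : ℝ≥0∞ := 2 ^ (n - β)
  have htk : t ≤ k * t := le_mul_of_one_le_left' <|
    (ENNReal.one_rpow _).symm.le.trans (ENNReal.rpow_le_rpow (by norm_num) (by linarith))
  by_contra! hle
  refine (mul_comm t _ ▸ ENNReal.mul_lt_of_lt_div hx).not_ge ?_
  calc rieszPotential β μ x
      = rieszPotential β (μ.restrict {y | rieszPotential β μ y ≤ t}) x +
          rieszPotential β (μ.restrict {y | t < rieszPotential β μ y}) x := by
        rw [← rieszPotential_restrict_add_compl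
          (isClosed_rieszPotential_le (β := β) (μ := μ) t).measurableSet]
        simp only [Set.compl_ofPred, not_le]
    _ ≤ k * t + k * t := add_le_add (rieszPotential_restrict_le hβ t x) (hle.trans htk)
    _ = 2 * k * t := by ring

theorem rieszPotential_div_rpow_le [SFinite μ] (hβ : β ≤ n) {a : ℝ} (ha : 0 ≤ a)
    (x : EuclideanSpace ℝ (Fin n)) :
    (rieszPotential β μ x / (2 * 2 ^ (n - β))) ^ (1 + a) ≤
      rieszPotential β (μ.withDensity fun y => rieszPotential β μ y ^ a) x := by
  have hm := measurable_rieszPotential β μ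
  rw [← ENNReal.le_rpow_inv_iff (by linarith)]
  refine le_of_forall_lt_imp_le_of_dense fun t ht => ?_
  rw [ENNReal.le_rpow_inv_iff (by linarith)]
  calc t ^ (1 + a) = t ^ a * t := by
        rw [add_comm, ENNReal.rpow_add_of_nonneg _ _ ha zero_le_one, ENNReal.rpow_one]
    _ ≤ t ^ a * rieszPotential β (μ.restrict {y | t < rieszPotential β μ y}) x := by
        gcongr; exact (lt_rieszPotential_restrict hβ ht).le
    _ = ∫⁻ y in {y | t < rieszPotential β μ y}, t ^ a * edist x y ^ (β - n) ∂μ :=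
        (lintegral_const_mul _ (by fun_prop)).symm
    _ ≤ ∫⁻ y in {y | t < rieszPotential β μ y},
          rieszPotential β μ y ^ a * edist x y ^ (β - n) ∂μ :=
        setLIntegral_mono' (measurableSet_lt measurable_const hm) fun y hy => by
          gcongr; exact le_of_lt hy
    _ ≤ ∫⁻ y, rieszPotential β μ y ^ a * edist x y ^ (β - n) ∂μ := setLIntegral_le_lintegral _ _
    _ = _ := (rieszPotential_withDensity (hm.pow_const a) x).symm

theorem ofReal_lt_edist_rpow_iff (hβ : β < n) {t : ℝ} (ht : 0 < t)
    {x y : EuclideanSpace ℝ (Fin n)} :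
    ENNReal.ofReal t < edist x y ^ (β - n) ↔ y ∈ Metric.ball x (t⁻¹ ^ (n - β)⁻¹) := by
  have hnβ : (0 : ℝ) < n - β := by linarith
  rw [← neg_sub (n : ℝ), ENNReal.rpow_neg, ENNReal.lt_inv_iff_lt_inv,
    ← ENNReal.lt_rpow_inv_iff hnβ, ← ENNReal.ofReal_inv_of_pos ht,
    ENNReal.ofReal_rpow_of_pos (by positivity), edist_dist,
    ENNReal.ofReal_lt_ofReal_iff (by positivity), Metric.mem_ball, dist_comm]

theorem rieszPotential_eq_lintegral_ball [SFinite μ] (hβ : β < n) (x : EuclideanSpace ℝ (Fin n)) :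
    rieszPotential β μ x = ∫⁻ t in Set.Ioi 0, μ (Metric.ball x (t⁻¹ ^ (n - β)⁻¹)) := by
  have hcake := lintegral_rpow_eq_lintegral_meas_ofReal_lt (μ := μ)
    (f := fun y => edist x y ^ (β - n)) (by fun_prop) one_pos
  simp only [ENNReal.rpow_one, sub_self, Real.rpow_zero, mul_one, ENNReal.ofReal_one,
    one_mul] at hcake
  rw [rieszPotential, hcake]
  refine setLIntegral_congr_fun measurableSet_Ioi fun t ht => congrArg μ ?_
  exact Set.ext fun y => ofReal_lt_edist_rpow_iff hβ ht

theorem edist_rpow_mul_measure_closedBall_le (hβ : β ≤ n) (x : EuclideanSpace ℝ (Fin n)) (R : ℝ) :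
    ENNReal.ofReal R ^ (β - n) * μ (Metric.closedBall x R) ≤ rieszPotential β μ x :=
  calc ENNReal.ofReal R ^ (β - n) * μ (Metric.closedBall x R)
      = ∫⁻ _ in Metric.closedBall x R, ENNReal.ofReal R ^ (β - n) ∂μ :=
        (setLIntegral_const _ _).symm
    _ ≤ ∫⁻ y in Metric.closedBall x R, edist x y ^ (β - n) ∂μ :=
        setLIntegral_mono' measurableSet_closedBall fun y hy =>
          antitone_ennreal_rpow_of_nonpos (by linarith) <| by
            rw [edist_dist, dist_comm]; exact ENNReal.ofReal_le_ofReal hy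
    _ ≤ rieszPotential β μ x := setLIntegral_le_lintegral _ _

theorem isLocallyFiniteMeasure_of_rieszPotential_ne_top (hβ : β ≤ n)
    {x : EuclideanSpace ℝ (Fin n)} (hx : rieszPotential β μ x ≠ ∞) : IsLocallyFiniteMeasure μ := by
  refine ⟨fun y => ⟨Metric.closedBall x (dist y x + 1),
    Metric.closedBall_mem_nhds_of_mem (Metric.mem_ball.2 (lt_add_one _)), ?_⟩⟩
  by_contra hball
  have hle := edist_rpow_mul_measure_closedBall_le (μ := μ) hβ x (dist y x + 1)
  rw [not_lt_top_iff.1 hball, ENNReal.mul_top, top_le_iff] at hle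
  · exact hx hle
  · have : ENNReal.ofReal (dist y x + 1) ≠ 0 := by
      rw [ENNReal.ofReal_ne_zero_iff]; positivity
    simp [ENNReal.rpow_eq_zero_iff, this]

end Potential

section WeakType

variable {n : ℕ} {β : ℝ}

theorem volume_ball_inv_rpow (hβ : β < n) {t : ℝ} (ht : 0 < t) (x : EuclideanSpace ℝ (Fin n)) :
    volume (Metric.ball x (t⁻¹ ^ (n - β)⁻¹)) = ENNReal.ofReal (t ^ (-(n / (n - β)))) *
      volume (Metric.ball (0 : EuclideanSpace ℝ (Fin n)) 1) := by
  have : (0 : ℝ) < n - β := by linarith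
  rw [Measure.addHaar_ball_of_pos _ _ (by positivity), finrank_euclideanSpace_fin,
    ← Real.rpow_natCast, ← Real.rpow_mul (by positivity), Real.inv_rpow ht.le,
    ← Real.rpow_neg ht.le, div_eq_inv_mul]

theorem rieszPotential_volume_restrict_le_add (hβ0 : 0 < β) (hβ : β < n)
    (E : Set (EuclideanSpace ℝ (Fin n))) (x : EuclideanSpace ℝ (Fin n)) {T : ℝ} (hT : 0 < T) :
    rieszPotential β (volume.restrict E) x ≤ ENNReal.ofReal T * volume E +
      ENNReal.ofReal (T ^ (1 - n / (n - β)) / (n / (n - β) - 1)) *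
        volume (Metric.ball (0 : EuclideanSpace ℝ (Fin n)) 1) := by
  have hp : 1 < n / (n - β) := (one_lt_div (by linarith)).2 (by linarith)
  set p : ℝ := n / (n - β)
  set c := volume (Metric.ball (0 : EuclideanSpace ℝ (Fin n)) 1)
  rw [rieszPotential_eq_lintegral_ball hβ, ← Set.Ioc_union_Ioi_eq_Ioi hT.le]
  refine (lintegral_union_le _ _ _).trans (add_le_add ?_ ?_)
  · calc ∫⁻ t in Set.Ioc 0 T, (volume.restrict E) (Metric.ball x (t⁻¹ ^ (n - β)⁻¹))
        ≤ ∫⁻ _ in Set.Ioc 0 T, volume E := lintegral_mono fun t =>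
          (measure_mono (Set.subset_univ _)).trans_eq (Measure.restrict_apply_univ E)
      _ = ENNReal.ofReal T * volume E := by
          rw [setLIntegral_const, Real.volume_Ioc, sub_zero, mul_comm]
  · calc ∫⁻ t in Set.Ioi T, (volume.restrict E) (Metric.ball x (t⁻¹ ^ (n - β)⁻¹))
        ≤ ∫⁻ t in Set.Ioi T, ENNReal.ofReal (t ^ (-p)) * c :=
          setLIntegral_mono' measurableSet_Ioi fun t ht =>
            (Measure.restrict_apply_le _ _).trans_eq (volume_ball_inv_rpow hβ (hT.trans ht) x)
      _ = ENNReal.ofReal (T ^ (1 - p) / (p - 1)) * c := by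
          rw [lintegral_mul_const _ (by fun_prop), ← ofReal_integral_eq_lintegral_ofReal
            (integrableOn_Ioi_rpow_of_lt (by linarith) hT),
            integral_Ioi_rpow_of_lt (by linarith) hT]
          · rw [neg_add_eq_sub, ← neg_sub p, neg_div_neg_eq]
          · filter_upwards [ae_restrict_mem measurableSet_Ioi] with t ht
            exact Real.rpow_nonneg (hT.trans ht).le _

theorem exists_rieszPotential_volume_restrict_le (hβ0 : 0 < β) (hβ : β < n) :
    ∃ C : ℝ≥0∞, C ≠ ∞ ∧ ∀ (E : Set (EuclideanSpace ℝ (Fin n))), volume E ≠ ∞ →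
      ∀ x, rieszPotential β (volume.restrict E) x ≤ C * volume E ^ (β / n) := by
  have hp : 1 < n / (n - β) := (one_lt_div (by linarith)).2 (by linarith)
  have hθ : 1 - (n / (n - β))⁻¹ = β / n := by
    rw [inv_div, one_sub_div (by linarith), sub_sub_cancel]
  set p : ℝ := n / (n - β)
  set c := volume (Metric.ball (0 : EuclideanSpace ℝ (Fin n)) 1)
  refine ⟨1 + ENNReal.ofReal (p - 1)⁻¹ * c,
    by finiteness [(measure_ball_lt_top : c < ∞).ne], fun E hE x => ?_⟩
  by_cases hE0 : volume E = 0
  · simp [Measure.restrict_eq_zero.2 hE0, rieszPotential_zero]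
  obtain ⟨M, hM, hME⟩ : ∃ M : ℝ, 0 < M ∧ volume E = ENNReal.ofReal M :=
    ⟨_, ENNReal.toReal_pos hE0 hE, (ENNReal.ofReal_toReal hE).symm⟩
  -- This threshold balances the two terms of the bound.
  have hsplit : rieszPotential β (volume.restrict E) x ≤ ENNReal.ofReal (M ^ (-p⁻¹)) * volume E +
      ENNReal.ofReal ((M ^ (-p⁻¹)) ^ (1 - p) / (p - 1)) * c :=
    rieszPotential_volume_restrict_le_add hβ0 hβ E x (by positivity)
  have hnear : ENNReal.ofReal (M ^ (-p⁻¹)) * volume E = volume E ^ (β / n) := by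
    rw [hME, ← ENNReal.ofReal_mul (by positivity), ENNReal.ofReal_rpow_of_pos hM, ← hθ,
      sub_eq_neg_add, Real.rpow_add_one hM.ne']
  have hfar : (M ^ (-p⁻¹)) ^ (1 - p) = M ^ (β / n) := by
    rw [← Real.rpow_mul hM.le, ← hθ, mul_one_sub, neg_mul, inv_mul_cancel₀ (by positivity)]
    ring_nf
  refine hsplit.trans_eq ?_
  rw [hnear, hfar, div_eq_inv_mul _ (p - 1), ENNReal.ofReal_mul (inv_nonneg.2 (by linarith)),
    ← ENNReal.ofReal_rpow_of_pos hM, ← hME]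
  ring

theorem le_rpow_of_mul_le_mul_rpow {t x M : ℝ≥0∞} (ht0 : t ≠ 0) (ht : t ≠ ∞) (hx : x ≠ ∞)
    {θ : ℝ} (hθ0 : 0 ≤ θ) (hθ1 : θ < 1) (h : t * x ≤ M * x ^ θ) : x ≤ (M / t) ^ (1 - θ)⁻¹ := by
  rcases eq_or_ne x 0 with rfl | hx0
  · exact zero_le
  have hxθ0 : x ^ θ ≠ 0 := by simp [ENNReal.rpow_eq_zero_iff, hx0, hx]
  rw [ENNReal.le_rpow_inv_iff (by linarith), ENNReal.le_div_iff_mul_le (.inl ht0) (.inl ht),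
    ← ENNReal.mul_le_mul_iff_left hxθ0 (ENNReal.rpow_ne_top_of_nonneg hθ0 hx)]
  calc x ^ (1 - θ) * t * x ^ θ = t * (x ^ (1 - θ) * x ^ θ) := by ring
    _ = t * x := by rw [← ENNReal.rpow_add _ _ hx0 hx, sub_add_cancel, ENNReal.rpow_one]
    _ ≤ M * x ^ θ := h

theorem exists_volume_lt_rieszPotential_le (hβ0 : 0 < β) (hβ : β < n) :
    ∃ C : ℝ≥0∞, C ≠ ∞ ∧ ∀ (ν : Measure (EuclideanSpace ℝ (Fin n))) [SFinite ν] (t : ℝ≥0∞),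
      t ≠ 0 → t ≠ ∞ →
      volume {x | t < rieszPotential β ν x} ≤ (C * ν Set.univ / t) ^ (n / (n - β)) := by
  have hn : (0 : ℝ) < n := hβ0.trans hβ
  obtain ⟨C, hC, hvol⟩ := exists_rieszPotential_volume_restrict_le (n := n) hβ0 hβ
  refine ⟨C, hC, fun ν _ t ht0 ht => ?_⟩
  rw [(isOpen_lt_rieszPotential t).measure_eq_iSup_isCompact]
  refine iSup₂_le fun K hKt => iSup_le fun hK => ?_
  have hKfin : volume K ≠ ∞ := hK.measure_lt_top.ne
  have hdual : t * volume K ≤ C * ν Set.univ * volume K ^ (β / n) :=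
    calc t * volume K = ∫⁻ _ in K, t := by rw [setLIntegral_const]
      _ ≤ ∫⁻ x in K, rieszPotential β ν x :=
        setLIntegral_mono (measurable_rieszPotential β ν) fun x hx => (hKt hx).le
      _ = ∫⁻ y, rieszPotential β (volume.restrict K) y ∂ν := lintegral_rieszPotential_comm
      _ ≤ ∫⁻ _, C * volume K ^ (β / n) ∂ν := lintegral_mono (hvol K hKfin)
      _ = _ := by rw [lintegral_const]; ring
  have hexp : (n : ℝ) / (n - β) = (1 - β / n)⁻¹ := by rw [one_sub_div hn.ne', inv_div]
  rw [hexp]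
  exact le_rpow_of_mul_le_mul_rpow ht0 ht hKfin (by positivity) ((div_lt_one hn).2 hβ) hdual

/-- The mass of `{t < I_β μ}` alone produces values above `t` of the potential wherever
`I_β μ` is large, so the weak type estimate applies to the restriction of `μ` to this set. -/
theorem exists_lintegral_rieszPotential_rpow_le (hβ0 : 0 < β) (hβ : β < n) {γ : ℝ} (hγ : 0 < γ) :
    ∃ C : ℝ≥0∞, C ≠ ∞ ∧ ∀ (μ : Measure (EuclideanSpace ℝ (Fin n))) [SFinite μ],
      ∫⁻ x, rieszPotential β μ x ^ ((1 + γ) * (n / (n - β))) ≤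
        C * (∫⁻ x, rieszPotential β μ x ^ γ ∂μ) ^ ((n : ℝ) / (n - β)) := by
  obtain ⟨C, hC, hweak⟩ := exists_volume_lt_rieszPotential_le (n := n) hβ0 hβ
  have hp : 1 ≤ n / (n - β) := (one_le_div (by linarith)).2 (by linarith)
  set p : ℝ := n / (n - β)
  set k : ℝ≥0∞ := 2 * 2 ^ (n - β)
  have hk0 : k ≠ 0 := by simp [k]
  have hk : k ≠ ∞ := by finiteness
  refine ⟨k ^ ((1 + γ) * p) * (C ^ p * ENNReal.ofReal ((1 + γ) * p / γ)), by finiteness,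
    fun μ _ => ?_⟩
  have hu := measurable_rieszPotential β μ
  set u := rieszPotential β μ
  have hlevel : ∀ t, t ≠ 0 → t ≠ ∞ →
      volume {x | t < u x / k} ≤ C ^ p * (μ {x | t < u x} / t) ^ p := fun t ht0 ht =>
    calc volume {x | t < u x / k}
        ≤ volume {x | t < rieszPotential β (μ.restrict {y | t < u y}) x} :=
          measure_mono fun x hx => lt_rieszPotential_restrict hβ.le hx
      _ ≤ (C * μ.restrict {y | t < u y} Set.univ / t) ^ p := hweak _ t ht0 ht
      _ = C ^ p * (μ {x | t < u x} / t) ^ p := by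
          rw [Measure.restrict_apply_univ, mul_div_assoc,
            ENNReal.mul_rpow_of_nonneg _ _ (by linarith)]
  calc ∫⁻ x, u x ^ ((1 + γ) * p)
      = ∫⁻ x, k ^ ((1 + γ) * p) * (u x / k) ^ ((1 + γ) * p) := lintegral_congr fun x => by
        rw [← ENNReal.mul_rpow_of_nonneg _ _ (by positivity), ENNReal.mul_div_cancel hk0 hk]
    _ = k ^ ((1 + γ) * p) * ∫⁻ x, (u x / k) ^ ((1 + γ) * p) := lintegral_const_mul _ (by fun_prop)
    _ ≤ k ^ ((1 + γ) * p) *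
          (C ^ p * ENNReal.ofReal ((1 + γ) * p / γ) * (∫⁻ x, u x ^ γ ∂μ) ^ p) := by
        gcongr
        exact lintegral_rpow_le_of_meas_lt_le (by fun_prop) hu hp hγ hlevel
    _ = _ := by ring

end WeakType

section Besicovitch

theorem exists_measure_le_of_forall_exists_ball_le_of_radius_le (X : Type*) [MetricSpace X]
    [SecondCountableTopology X] [MeasurableSpace X] [OpensMeasurableSpace X]
    [HasBesicovitchCovering X] :
    ∃ N : ℕ, ∀ (σ ω : Measure X) (E : Set X) (R : ℝ),
      (∀ x ∈ E, ∃ ρ, 0 < ρ ∧ ρ ≤ R ∧ σ (Metric.ball x ρ) ≤ ω (Metric.ball x ρ)) →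
      σ E ≤ N * ω Set.univ := by
  obtain ⟨N, τ, hτ, hN⟩ := HasBesicovitchCovering.no_satelliteConfig (α := X)
  refine ⟨N, fun σ ω E R hE => ?_⟩
  choose ρ hρ0 hρR hρ using fun x : E => hE x x.2
  obtain ⟨s, hdisj, hcov⟩ := Besicovitch.exist_disjoint_covering_families hτ hN
    { c := fun x : E => (x : X), r := ρ, rpos := hρ0, r_bound := R, r_le := hρR }
  have hdisj' : ∀ i, (s i).PairwiseDisjoint fun j : E => Metric.ball (j : X) (ρ j) := fun i =>
    (hdisj i).mono fun _ => Metric.ball_subset_closedBall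
  have hcount : ∀ i, (s i).Countable := fun i =>
    (hdisj' i).countable_of_isOpen (fun _ _ => Metric.isOpen_ball)
      fun j _ => ⟨j, Metric.mem_ball_self (hρ0 j)⟩
  have hcover : E ⊆ ⋃ i, ⋃ j ∈ s i, Metric.ball (j : X) (ρ j) := fun x hx => by
    simpa only [Set.mem_iUnion] using hcov ⟨⟨x, hx⟩, rfl⟩
  calc σ E ≤ ∑ i, σ (⋃ j ∈ s i, Metric.ball (j : X) (ρ j)) :=
        (measure_mono hcover).trans (measure_iUnion_fintype_le _ _)
    _ ≤ ∑ i, ∑' j : s i, σ (Metric.ball (j : X) (ρ j)) :=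
        Finset.sum_le_sum fun i _ => measure_biUnion_le σ (hcount i) _
    _ ≤ ∑ i, ∑' j : s i, ω (Metric.ball (j : X) (ρ j)) :=
        Finset.sum_le_sum fun i _ => ENNReal.tsum_le_tsum fun j => hρ j
    _ = ∑ i, ω (⋃ j ∈ s i, Metric.ball (j : X) (ρ j)) :=
        Finset.sum_congr rfl fun i _ =>
          (measure_biUnion (hcount i) (hdisj' i) fun _ _ => measurableSet_ball).symm
    _ ≤ ∑ _i : Fin N, ω Set.univ := Finset.sum_le_sum fun i _ => measure_mono (Set.subset_univ _)
    _ = N * ω Set.univ := by simp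

theorem exists_measure_le_of_forall_exists_ball_le (X : Type*) [MetricSpace X]
    [SecondCountableTopology X] [MeasurableSpace X] [OpensMeasurableSpace X]
    [HasBesicovitchCovering X] :
    ∃ N : ℕ, ∀ (σ ω : Measure X) (E : Set X),
      (∀ x ∈ E, ∃ ρ > 0, σ (Metric.ball x ρ) ≤ ω (Metric.ball x ρ)) →
      σ E ≤ N * ω Set.univ := by
  obtain ⟨N, hN⟩ := exists_measure_le_of_forall_exists_ball_le_of_radius_le X
  refine ⟨N, fun σ ω E hE => ?_⟩
  let F : ℕ → Set X := fun R =>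
    {x | x ∈ E ∧ ∃ ρ : ℝ, 0 < ρ ∧ ρ ≤ R ∧ σ (Metric.ball x ρ) ≤ ω (Metric.ball x ρ)}
  have hF : Monotone F := fun i j hij x ⟨hx, ρ, hρ, hle, h⟩ =>
    ⟨hx, ρ, hρ, hle.trans (by exact_mod_cast hij), h⟩
  have hEF : E ⊆ ⋃ R, F R := fun x hx => by
    obtain ⟨ρ, hρ, h⟩ := hE x hx
    exact Set.mem_iUnion.2 ⟨⌈ρ⌉₊, hx, ρ, hρ, Nat.le_ceil ρ, h⟩
  calc σ E ≤ σ (⋃ R, F R) := measure_mono hEF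
    _ = ⨆ R, σ (F R) := hF.measure_iUnion
    _ ≤ N * ω Set.univ := iSup_le fun R => hN σ ω (F R) R fun x hx => hx.2

end Besicovitch

section NormInequality

variable {n : ℕ} {β : ℝ} {σ : Measure (EuclideanSpace ℝ (Fin n))}

theorem exists_measure_rieszPotential_lt_le (n : ℕ) :
    ∃ N : ℕ, ∀ β : ℝ, β < n → ∀ (σ ω : Measure (EuclideanSpace ℝ (Fin n))) [SFinite σ] [SFinite ω],
      σ {x | rieszPotential β σ x < rieszPotential β ω x} ≤ N * ω Set.univ := by
  obtain ⟨N, hN⟩ := exists_measure_le_of_forall_exists_ball_le (EuclideanSpace ℝ (Fin n))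
  refine ⟨N, fun β hβ σ ω _ _ => hN σ ω _ fun x hx => ?_⟩
  by_contra! hball
  refine (Set.mem_ofPred_eq ▸ hx).not_ge ?_
  rw [rieszPotential_eq_lintegral_ball hβ, rieszPotential_eq_lintegral_ball hβ]
  refine setLIntegral_mono' measurableSet_Ioi fun t ht => ?_
  exact (hball _ (Real.rpow_pos_of_pos (inv_pos.2 ht) _)).le

theorem rieszPotential_withDensity_restrict_le {g : EuclideanSpace ℝ (Fin n) → ℝ≥0∞}
    (hg : Measurable g) (s : ℝ≥0∞) (x : EuclideanSpace ℝ (Fin n)) :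
    rieszPotential β ((σ.withDensity g).restrict {y | g y ≤ s}) x ≤ s * rieszPotential β σ x := by
  have hm : MeasurableSet {y | g y ≤ s} := measurableSet_le hg measurable_const
  rw [restrict_withDensity hm, rieszPotential_withDensity hg]
  calc ∫⁻ y in {y | g y ≤ s}, g y * edist x y ^ (β - n) ∂σ
      ≤ ∫⁻ y in {y | g y ≤ s}, s * edist x y ^ (β - n) ∂σ :=
        setLIntegral_mono' hm fun y hy => by gcongr; exact hy
    _ ≤ ∫⁻ y, s * edist x y ^ (β - n) ∂σ := setLIntegral_le_lintegral _ _
    _ = s * rieszPotential β σ x := lintegral_const_mul _ (by fun_prop)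

theorem mul_rieszPotential_lt_of_lt_div {g : EuclideanSpace ℝ (Fin n) → ℝ≥0∞} (hg : Measurable g)
    {s : ℝ≥0∞} {x : EuclideanSpace ℝ (Fin n)}
    (hx : 2 * s < rieszPotential β (σ.withDensity g) x / rieszPotential β σ x) :
    s * rieszPotential β σ x < rieszPotential β ((σ.withDensity g).restrict {y | s < g y}) x := by
  by_contra! hle
  refine (ENNReal.mul_lt_of_lt_div hx).not_ge ?_
  calc rieszPotential β (σ.withDensity g) x
      = rieszPotential β ((σ.withDensity g).restrict {y | g y ≤ s}) x +
          rieszPotential β ((σ.withDensity g).restrict {y | s < g y}) x := by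
        rw [← rieszPotential_restrict_add_compl (measurableSet_le hg (measurable_const (a := s)))]
        simp only [Set.compl_ofPred, not_le]
    _ ≤ s * rieszPotential β σ x + s * rieszPotential β σ x :=
        add_le_add (rieszPotential_withDensity_restrict_le hg s x) hle
    _ = 2 * s * rieszPotential β σ x := by ring

theorem exists_measure_lt_rieszPotential_div_le (n : ℕ) :
    ∃ N : ℕ, ∀ β : ℝ, β < n → ∀ (σ : Measure (EuclideanSpace ℝ (Fin n))) [SFinite σ]
      (g : EuclideanSpace ℝ (Fin n) → ℝ≥0∞), Measurable g → ∀ s : ℝ≥0∞,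
      s * σ {x | 2 * s < rieszPotential β (σ.withDensity g) x / rieszPotential β σ x} ≤
        N * σ.withDensity g {x | s < g x} := by
  obtain ⟨N, hN⟩ := exists_measure_rieszPotential_lt_le n
  refine ⟨N, fun β hβ σ _ g hg s => ?_⟩
  set ω := (σ.withDensity g).restrict {x | s < g x} with hω
  calc s * σ {x | 2 * s < rieszPotential β (σ.withDensity g) x / rieszPotential β σ x}
      ≤ (s • σ) {x | rieszPotential β (s • σ) x < rieszPotential β ω x} := by
        rw [Measure.smul_apply, smul_eq_mul]
        refine mul_le_mul_right (measure_mono fun x hx => ?_) _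
        simpa only [Set.mem_ofPred_eq, rieszPotential_smul] using
          mul_rieszPotential_lt_of_lt_div hg hx
    _ ≤ N * ω Set.univ := hN β hβ (s • σ) ω
    _ = N * σ.withDensity g {x | s < g x} := by rw [hω, Measure.restrict_apply_univ]

theorem exists_lintegral_rieszPotential_div_rpow_le (n : ℕ) {p : ℝ} (hp : 1 < p) :
    ∃ C : ℝ≥0∞, C ≠ ∞ ∧ ∀ β : ℝ, β < n → ∀ (σ : Measure (EuclideanSpace ℝ (Fin n))) [SFinite σ]
      (g : EuclideanSpace ℝ (Fin n) → ℝ≥0∞), Measurable g →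
      ∫⁻ x, (rieszPotential β (σ.withDensity g) x / rieszPotential β σ x) ^ p ∂σ ≤
        C * ∫⁻ x, g x ^ p ∂σ := by
  obtain ⟨N, hN⟩ := exists_measure_lt_rieszPotential_div_le n
  obtain ⟨γ, hγ, rfl⟩ : ∃ γ : ℝ, 0 < γ ∧ p = 1 + γ := ⟨p - 1, by linarith, by ring⟩
  refine ⟨2 * N * ENNReal.ofReal ((1 + γ) / γ) * 2 ^ γ, by finiteness, fun β hβ σ _ g hg => ?_⟩
  have hv := measurable_rieszPotential β (σ.withDensity g)
  have hK := measurable_rieszPotential β σ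
  have hlevel : ∀ t : ℝ≥0∞, t ≠ 0 → t ≠ ∞ →
      σ {x | t < rieszPotential β (σ.withDensity g) x / rieszPotential β σ x} ≤
        2 * N * (σ.withDensity g {x | t < 2 * g x} / t) ^ (1 : ℝ) := fun t ht0 ht => by
    obtain ⟨s, rfl⟩ : ∃ s, t = 2 * s := ⟨t / 2, (ENNReal.mul_div_cancel two_ne_zero (by simp)).symm⟩
    have hs0 : s ≠ 0 := right_ne_zero_of_mul ht0
    have hst : s ≠ ∞ := fun h => ht (by simp [h])
    simp only [ENNReal.mul_lt_mul_iff_right two_ne_zero ENNReal.ofNat_ne_top, ENNReal.rpow_one]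
    calc _ ≤ N * σ.withDensity g {x | s < g x} / s := by
          rw [ENNReal.le_div_iff_mul_le (Or.inl hs0) (Or.inl hst), mul_comm]
          exact hN β hβ σ g hg s
      _ = _ := by
          rw [mul_comm 2, mul_assoc, ← mul_div_assoc 2,
            ENNReal.mul_div_mul_left _ _ two_ne_zero ENNReal.ofNat_ne_top, mul_div_assoc]
  calc ∫⁻ x, (rieszPotential β (σ.withDensity g) x / rieszPotential β σ x) ^ (1 + γ) ∂σ
      ≤ 2 * N * ENNReal.ofReal ((1 + γ) / γ) * ∫⁻ x, (2 * g x) ^ γ ∂σ.withDensity g := by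
        simpa only [mul_one, ENNReal.rpow_one, Pi.div_apply] using
          lintegral_rpow_le_of_meas_lt_le (hv.div hK) (hg.const_mul 2) le_rfl hγ hlevel
    _ = 2 * N * ENNReal.ofReal ((1 + γ) / γ) * (2 ^ γ * ∫⁻ x, g x ^ (1 + γ) ∂σ) := by
        rw [lintegral_withDensity_eq_lintegral_mul _ hg (by fun_prop),
          ← lintegral_const_mul (2 ^ γ) (by fun_prop)]
        refine congrArg _ (lintegral_congr fun x => ?_)
        rw [Pi.mul_apply, ENNReal.mul_rpow_of_nonneg _ _ hγ.le,
          ENNReal.rpow_add_of_nonneg _ _ zero_le_one hγ.le, ENNReal.rpow_one]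
        ring
    _ = _ := by ring

/-- Hölder's inequality with exponents `1 / q` and `1 / (1 - q)`, applied to
`I(f^q dσ) = (I(f^q dσ) / Iσ) * Iσ`. -/
theorem exists_lintegral_rieszPotential_powMeasure_rpow_le (hβ : β < n) {q s : ℝ} (hq0 : 0 < q)
    (hq1 : q < 1) (hs : q < s) [SFinite σ]
    (hK : ∫⁻ x, rieszPotential β σ x ^ (s / (1 - q)) ∂σ ≠ ∞) :
    ∃ C : ℝ≥0∞, C ≠ ∞ ∧ ∀ f : EuclideanSpace ℝ (Fin n) → ℝ≥0∞, Measurable f →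
      ∫⁻ x, rieszPotential β (powMeasure f q σ) x ^ s ∂σ ≤ C * (∫⁻ x, f x ^ s ∂σ) ^ q := by
  have : 0 < 1 - q := by linarith
  have hs0 : 0 < s := hq0.trans hs
  rcases eq_or_ne σ 0 with rfl | hσ
  · exact ⟨0, by simp, by simp⟩
  obtain ⟨C, hC, hCle⟩ :=
    exists_lintegral_rieszPotential_div_rpow_le n (p := s / q) (by rwa [one_lt_div hq0])
  have hKm : Measurable (rieszPotential β σ) := measurable_rieszPotential β σ
  have hKt : ∀ᵐ x ∂σ, rieszPotential β σ x ≠ ∞ := by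
    filter_upwards [ae_lt_top (hKm.pow_const _) hK] with x hx
    exact (ENNReal.rpow_lt_top_iff_of_pos (by positivity)).1 hx |>.ne
  have hconj : (q⁻¹).HolderConjugate (1 - q)⁻¹ :=
    Real.holderConjugate_iff.2 ⟨(one_lt_inv₀ hq0).2 hq1, by simp⟩
  refine ⟨C ^ q * (∫⁻ x, rieszPotential β σ x ^ (s / (1 - q)) ∂σ) ^ (1 - q), by finiteness,
    fun f hf => ?_⟩
  have hdiv := hCle β hβ σ (fun y => f y ^ q) (hf.pow_const q)
  have hvm := measurable_rieszPotential β (σ.withDensity fun y => f y ^ q)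
  change ∫⁻ x, rieszPotential β (σ.withDensity fun y => f y ^ q) x ^ s ∂σ ≤ _
  set v := rieszPotential β (σ.withDensity fun y => f y ^ q)
  set K := rieszPotential β σ
  calc ∫⁻ x, v x ^ s ∂σ = ∫⁻ x, ((fun x => (v x / K x) ^ s) * fun x => K x ^ s) x ∂σ := by
        refine lintegral_congr_ae ?_
        filter_upwards [hKt] with x hx
        rw [Pi.mul_apply, ← ENNReal.mul_rpow_of_nonneg _ _ hs0.le,
          ENNReal.div_mul_cancel (rieszPotential_ne_zero hβ.le hσ x) hx]
    _ ≤ (∫⁻ x, ((v x / K x) ^ s) ^ q⁻¹ ∂σ) ^ (1 / q⁻¹) *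
          (∫⁻ x, (K x ^ s) ^ (1 - q)⁻¹ ∂σ) ^ (1 / (1 - q)⁻¹) :=
        ENNReal.lintegral_mul_le_Lp_mul_Lq σ hconj (by fun_prop) (by fun_prop)
    _ = (∫⁻ x, (v x / K x) ^ (s / q) ∂σ) ^ q * (∫⁻ x, K x ^ (s / (1 - q)) ∂σ) ^ (1 - q) := by
        simp_rw [← ENNReal.rpow_mul, ← div_eq_mul_inv, one_div, inv_inv]
    _ ≤ (C * ∫⁻ x, f x ^ s ∂σ) ^ q * (∫⁻ x, K x ^ (s / (1 - q)) ∂σ) ^ (1 - q) := by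
        gcongr
        simpa only [← ENNReal.rpow_mul, mul_div_cancel₀ s hq0.ne'] using hdiv
    _ = _ := by rw [ENNReal.mul_rpow_of_nonneg _ _ hq0.le]; ring

end NormInequality

section PowPotential

variable {n : ℕ} {β q : ℝ} {σ : Measure (EuclideanSpace ℝ (Fin n))}

/-- The nonlinear operator `u ↦ I_β(u^q dσ)`. Its fixed points are the solutions of the integral
equation, and a positive solution is constructed as the supremum of its iterates. -/
noncomputable def powPotential {n : ℕ} (β q : ℝ) (σ : Measure (EuclideanSpace ℝ (Fin n)))
    (u : EuclideanSpace ℝ (Fin n) → ℝ≥0∞) : EuclideanSpace ℝ (Fin n) → ℝ≥0∞ :=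
  rieszPotential β (powMeasure u q σ)

theorem measurable_powPotential [SFinite σ] (u : EuclideanSpace ℝ (Fin n) → ℝ≥0∞) :
    Measurable (powPotential β q σ u) := by
  unfold powPotential powMeasure
  exact measurable_rieszPotential β _

theorem powPotential_apply {u : EuclideanSpace ℝ (Fin n) → ℝ≥0∞} (hu : Measurable u)
    (x : EuclideanSpace ℝ (Fin n)) :
    powPotential β q σ u x = ∫⁻ y, u y ^ q * edist x y ^ (β - n) ∂σ :=
  rieszPotential_withDensity (hu.pow_const q) x

theorem monotone_powPotential (hq : 0 ≤ q) : Monotone (powPotential β q σ) := fun _ _ huv =>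
  rieszPotential_mono <| withDensity_mono <| Eventually.of_forall fun x =>
    ENNReal.rpow_le_rpow (huv x) hq

theorem powPotential_iSup (hq : 0 < q) {f : ℕ → EuclideanSpace ℝ (Fin n) → ℝ≥0∞}
    (hf : ∀ j, Measurable (f j)) (hmono : Monotone f) (x : EuclideanSpace ℝ (Fin n)) :
    powPotential β q σ (fun y => ⨆ j, f j y) x = ⨆ j, powPotential β q σ (f j) x := by
  have hpow : ∀ y, (⨆ j, f j y) ^ q = ⨆ j, f j y ^ q := fun y =>
    (ENNReal.orderIsoRpow q hq).map_iSup _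
  rw [powPotential_apply (Measurable.iSup hf)]
  simp only [hpow, ENNReal.iSup_mul, powPotential_apply (hf _)]
  exact lintegral_iSup (fun j => by have := hf j; fun_prop) fun i j hij y =>
    mul_le_mul_left (ENNReal.rpow_le_rpow (hmono hij y) hq.le) _

theorem measurable_powPotential_iterate [SFinite σ] {u : EuclideanSpace ℝ (Fin n) → ℝ≥0∞}
    (hu : Measurable u) : ∀ j, Measurable ((powPotential β q σ)^[j] u)
  | 0 => hu
  | j + 1 => by rw [Function.iterate_succ_apply']; exact measurable_powPotential _

theorem powPotential_iSup_iterate [SFinite σ] (hq : 0 < q)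
    {u : EuclideanSpace ℝ (Fin n) → ℝ≥0∞} (hu : Measurable u) (hsub : u ≤ powPotential β q σ u) :
    powPotential β q σ (fun x => ⨆ j, (powPotential β q σ)^[j] u x) =
      fun x => ⨆ j, (powPotential β q σ)^[j] u x := by
  have hmono := (monotone_powPotential hq.le).monotone_iterate_of_le_map hsub
  ext x
  rw [powPotential_iSup hq (measurable_powPotential_iterate hu) hmono]
  simp only [← Function.iterate_succ_apply' (powPotential β q σ)]
  exact Monotone.iSup_nat_add (fun i j hij => hmono hij x) 1

theorem mul_rpow_le_of_rpow_inv_le (hq0 : 0 ≤ q) (hq1 : q < 1) {C B : ℝ≥0∞}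
    (h : C ^ (1 - q)⁻¹ ≤ B) : C * B ^ q ≤ B := by
  have hq : 0 < 1 - q := by linarith
  calc C * B ^ q ≤ B ^ (1 - q) * B ^ q := by
        gcongr; exact (ENNReal.rpow_inv_le_iff hq).1 h
    _ = B := by
        rw [← ENNReal.rpow_add_of_nonneg _ _ hq.le hq0, sub_add_cancel, ENNReal.rpow_one]

theorem lintegral_powPotential_iterate_rpow_le [SFinite σ] (hq0 : 0 ≤ q) (hq1 : q < 1) {s : ℝ}
    {C : ℝ≥0∞} (hC : ∀ f : EuclideanSpace ℝ (Fin n) → ℝ≥0∞, Measurable f →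
      ∫⁻ x, powPotential β q σ f x ^ s ∂σ ≤ C * (∫⁻ x, f x ^ s ∂σ) ^ q)
    {u : EuclideanSpace ℝ (Fin n) → ℝ≥0∞} (hu : Measurable u) (j : ℕ) :
    ∫⁻ x, (powPotential β q σ)^[j] u x ^ s ∂σ ≤ max (∫⁻ x, u x ^ s ∂σ) (C ^ (1 - q)⁻¹) := by
  induction j with
  | zero => exact le_max_left _ _
  | succ j ih =>
    rw [Function.iterate_succ_apply']
    calc _ ≤ C * (∫⁻ x, (powPotential β q σ)^[j] u x ^ s ∂σ) ^ q :=
          hC _ (measurable_powPotential_iterate hu j)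
      _ ≤ C * max (∫⁻ x, u x ^ s ∂σ) (C ^ (1 - q)⁻¹) ^ q := by gcongr
      _ ≤ _ := mul_rpow_le_of_rpow_inv_le hq0 hq1 (le_max_right _ _)

theorem exists_mul_rieszPotential_rpow_le_powPotential [SFinite σ] (hβ : β ≤ n) (hq0 : 0 ≤ q)
    (hq1 : q < 1) : ∃ c : ℝ≥0∞, c ≠ 0 ∧ c ≠ ∞ ∧
      (fun x => c * rieszPotential β σ x ^ (1 - q)⁻¹) ≤
        powPotential β q σ fun x => c * rieszPotential β σ x ^ (1 - q)⁻¹ := by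
  have hq : 0 < 1 - q := by linarith
  set p := (1 - q)⁻¹ with hp
  have hp0 : 0 < p := inv_pos.2 hq
  have hpq : 1 + q * p = p := by rw [hp]; field_simp; ring
  set k : ℝ≥0∞ := 2 * 2 ^ (n - β)
  have hk0 : k ≠ 0 := by simp [k, ENNReal.rpow_eq_zero_iff]
  have hk : k ≠ ∞ := by finiteness
  have hKm : Measurable (rieszPotential β σ) := measurable_rieszPotential β σ
  set c : ℝ≥0∞ := k ^ (-(p * p))
  have hc : c = c ^ q * (k ^ p)⁻¹ := by
    rw [← ENNReal.rpow_neg, ← ENNReal.rpow_mul, ← ENNReal.rpow_add _ _ hk0 hk]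
    refine congrArg (k ^ ·) ?_
    linear_combination p * hpq
  refine ⟨c, by simp [c, ENNReal.rpow_eq_zero_iff, hk0, hk],
    ENNReal.rpow_ne_top_of_ne_zero hk0 hk, fun x => ?_⟩
  have hpow : ∀ y, (c * rieszPotential β σ y ^ p) ^ q = c ^ q * rieszPotential β σ y ^ (q * p) :=
    fun y => by rw [ENNReal.mul_rpow_of_nonneg _ _ hq0, mul_comm q, ENNReal.rpow_mul]
  calc c * rieszPotential β σ x ^ p
      = c ^ q * (rieszPotential β σ x / k) ^ (1 + q * p) := by
        rw [hpq, ENNReal.div_rpow_of_nonneg _ _ hp0.le, div_eq_mul_inv,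
          mul_comm (rieszPotential β σ x ^ p), ← mul_assoc, ← hc]
    _ ≤ c ^ q * ∫⁻ y, rieszPotential β σ y ^ (q * p) * edist x y ^ (β - n) ∂σ := by
        rw [← rieszPotential_withDensity (hKm.pow_const _)]
        gcongr
        exact rieszPotential_div_rpow_le hβ (by positivity) x
    _ = powPotential β q σ (fun y => c * rieszPotential β σ y ^ p) x := by
        rw [powPotential_apply (by fun_prop), ← lintegral_const_mul _ (by fun_prop)]
        simp only [hpow, mul_assoc]

theorem exists_pos_fixedPoint_powPotential [SFinite σ] (hβ : β < n) (hq0 : 0 < q) (hq1 : q < 1)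
    {s : ℝ} (hs : q < s) (hσ : σ ≠ 0)
    (hK : ∫⁻ x, rieszPotential β σ x ^ (s / (1 - q)) ∂σ ≠ ∞) :
    ∃ u : EuclideanSpace ℝ (Fin n) → ℝ≥0∞, Measurable u ∧ powPotential β q σ u = u ∧
      (∀ x, 0 < u x) ∧ ∫⁻ x, u x ^ s ∂σ ≠ ∞ := by
  have hs0 : 0 < s := hq0.trans hs
  have hKm : Measurable (rieszPotential β σ) := measurable_rieszPotential β σ
  obtain ⟨c, hc0, hc, hsub⟩ :=
    exists_mul_rieszPotential_rpow_le_powPotential (σ := σ) hβ.le hq0.le hq1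
  obtain ⟨C, hC, hnorm⟩ := exists_lintegral_rieszPotential_powMeasure_rpow_le hβ hq0 hq1 hs hK
  set u₀ : EuclideanSpace ℝ (Fin n) → ℝ≥0∞ := fun x => c * rieszPotential β σ x ^ (1 - q)⁻¹
  have hu₀ : Measurable u₀ := by fun_prop
  have hu₀pos : ∀ x, 0 < u₀ x := fun x => pos_iff_ne_zero.2 <| mul_ne_zero hc0 <| by
    simp [ENNReal.rpow_eq_zero_iff, rieszPotential_ne_zero hβ.le hσ x, hq1.le]
  have hu₀int : ∫⁻ x, u₀ x ^ s ∂σ ≠ ∞ := by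
    simp only [u₀, ENNReal.mul_rpow_of_nonneg _ _ hs0.le, ← ENNReal.rpow_mul, ← div_eq_inv_mul]
    rw [lintegral_const_mul _ (by fun_prop)]
    finiteness
  have hmeas := measurable_powPotential_iterate (β := β) (q := q) (σ := σ) hu₀
  have hmono := (monotone_powPotential hq0.le).monotone_iterate_of_le_map hsub
  refine ⟨fun x => ⨆ j, (powPotential β q σ)^[j] u₀ x, Measurable.iSup hmeas,
    powPotential_iSup_iterate hq0 hu₀ hsub, fun x => ?_, ne_top_of_le_ne_top
      (max_lt hu₀int.lt_top
        (ENNReal.rpow_lt_top_of_nonneg (inv_nonneg.2 (sub_nonneg.2 hq1.le)) hC)).ne ?_⟩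
  · exact (hu₀pos x).trans_le (le_iSup (fun j => (powPotential β q σ)^[j] u₀ x) 0)
  · have hpow : ∀ x, (⨆ j, (powPotential β q σ)^[j] u₀ x) ^ s =
        ⨆ j, (powPotential β q σ)^[j] u₀ x ^ s := fun x =>
      (ENNReal.orderIsoRpow s hs0).map_iSup _
    rw [lintegral_congr hpow, lintegral_iSup (fun j => (hmeas j).pow_const s) fun i j hij x =>
      ENNReal.rpow_le_rpow (hmono hij x) hs0.le]
    exact iSup_le (lintegral_powPotential_iterate_rpow_le hq0.le hq1 hnorm hu₀)

theorem lintegral_rpow_ne_top_of_fixedPoint_powPotential [SFinite σ] (hβ0 : 0 < β) (hβ : β < n)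
    (hq : 0 ≤ q) {γ : ℝ} (hγ : 0 < γ) {u : EuclideanSpace ℝ (Fin n) → ℝ≥0∞} (hu : Measurable u)
    (hfix : powPotential β q σ u = u) (hint : ∫⁻ x, u x ^ (γ + q) ∂σ ≠ ∞) :
    ∫⁻ x, u x ^ ((1 + γ) * (n / (n - β))) ≠ ∞ := by
  obtain ⟨C, hC, hweak⟩ := exists_lintegral_rieszPotential_rpow_le hβ0 hβ hγ
  have henergy : ∫⁻ x, u x ^ γ ∂powMeasure u q σ = ∫⁻ x, u x ^ (γ + q) ∂σ := by
    rw [powMeasure, lintegral_withDensity_eq_lintegral_mul _ (by fun_prop) (by fun_prop)]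
    refine lintegral_congr fun x => ?_
    rw [Pi.mul_apply, add_comm, ENNReal.rpow_add_of_nonneg _ _ hq hγ.le]
  have : SFinite (powMeasure u q σ) := by unfold powMeasure; infer_instance
  have hle := hweak (powMeasure u q σ)
  rw [show rieszPotential β (powMeasure u q σ) = u from hfix, henergy] at hle
  have hn : (0 : ℝ) ≤ n / (n - β) := div_nonneg (by linarith) (by linarith)
  exact ne_top_of_le_ne_top (by finiteness) hle

end PowPotential

section MemLp

theorem memLp_ofReal_iff {X : Type*} [MeasurableSpace X] {μ : Measure X} {f : X → ℝ≥0∞} {a : ℝ}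
    (ha : 0 < a) : MemLp f (ENNReal.ofReal a) μ ↔
      AEStronglyMeasurable f μ ∧ ∫⁻ x, f x ^ a ∂μ < ∞ := by
  rw [MemLp, eLpNorm_lt_top_iff_lintegral_rpow_enorm_lt_top (by simpa using ha)
    ENNReal.ofReal_ne_top, ENNReal.toReal_ofReal ha.le]
  simp only [enorm_eq_self]

theorem memLpLoc_of_memLp {n : ℕ} {u : EuclideanSpace ℝ (Fin n) → ℝ≥0∞} {q s : ℝ}
    {σ : Measure (EuclideanSpace ℝ (Fin n))} [IsFiniteMeasureOnCompacts σ] (hqs : q ≤ s)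
    (hu : MemLp u (ENNReal.ofReal s) σ) : MemLpLoc u q σ := fun K hK =>
  have : IsFiniteMeasure (σ.restrict K) := isFiniteMeasure_restrict.2 hK.measure_ne_top
  (hu.restrict K).mono_exponent (ENNReal.ofReal_le_ofReal hqs)

theorem liminf_cocompact_eq_zero_of_memLp {X : Type*} [TopologicalSpace X] [MeasurableSpace X]
    {μ : Measure X} [IsFiniteMeasureOnCompacts μ] (hμ : μ Set.univ = ∞) {f : X → ℝ≥0∞}
    {p : ℝ≥0∞} (hp0 : p ≠ 0) (hp : p ≠ ∞) (hf : MemLp f p μ) : liminf f (cocompact X) = 0 := by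
  by_contra hne
  obtain ⟨c, hc0, hc⟩ := exists_between (pos_iff_ne_zero.2 hne)
  obtain ⟨K, hK, hKc⟩ := mem_cocompact.1 (eventually_lt_of_lt_liminf hc)
  have hlarge : μ {x | c ≤ f x} < ∞ := by
    simpa only [enorm_eq_self] using
      hf.meas_ge_lt_top'_enorm hp0 hp hc0.ne' fun hct => absurd hct hc.ne_top
  have hcover : Set.univ ⊆ K ∪ {x | c ≤ f x} := fun x _ =>
    or_iff_not_imp_left.2 fun hx => Set.mem_ofPred_eq ▸ (hKc hx : c < f x).le
  exact (measure_mono hcover |>.trans (measure_union_le _ _)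
    |>.trans_lt (ENNReal.add_lt_top.2 ⟨hK.measure_lt_top, hlarge⟩)).ne hμ

end MemLp

section Existence

variable {n : ℕ} {α q γ : ℝ} {σ : Measure (EuclideanSpace ℝ (Fin n))}

theorem isLocallyFiniteMeasure_of_memLp_rieszPotential {β a : ℝ} (hβ : β ≤ n) (ha : 0 < a)
    (hσ : σ ≠ 0) (hK : MemLp (rieszPotential β σ) (ENNReal.ofReal a) σ) :
    IsLocallyFiniteMeasure σ := by
  obtain ⟨hKm, hKint⟩ := (memLp_ofReal_iff ha).1 hK
  have : (ae σ).NeBot := ae_neBot.2 hσ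
  obtain ⟨x, hx⟩ := (ae_lt_top' (hKm.aemeasurable.pow_const a) hKint.ne).exists
  exact isLocallyFiniteMeasure_of_rieszPotential_ne_top hβ
    ((ENNReal.rpow_lt_top_iff_of_pos ha).1 hx).ne

theorem exists_isSolution_pos_memLp (hα0 : 0 < α) (hαn : 2 * α < n) (hq0 : 0 < q) (hq1 : q < 1)
    (hγ : 0 < γ) (hσ : σ ≠ 0)
    (hK : MemLp (rieszPotential (2 * α) σ) (ENNReal.ofReal ((γ + q) / (1 - q))) σ) :
    ∃ u : EuclideanSpace ℝ (Fin n) → ℝ≥0∞, IsSolution α q σ u ∧ (∀ x, 0 < u x) ∧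
      MemLp u (ENNReal.ofReal ((1 + γ) * (n / (n - 2 * α)))) volume := by
  have hs : 0 < (γ + q) / (1 - q) := div_pos (by linarith) (by linarith)
  have hn : (0 : ℝ) < n / (n - 2 * α) := div_pos (by linarith) (by linarith)
  have := isLocallyFiniteMeasure_of_memLp_rieszPotential hαn.le hs hσ hK
  obtain ⟨u, hum, hfix, hpos, hint⟩ := exists_pos_fixedPoint_powPotential hαn hq0 hq1
    (lt_add_of_pos_left q hγ) hσ ((memLp_ofReal_iff hs).1 hK).2.ne
  have hur := lintegral_rpow_ne_top_of_fixedPoint_powPotential (by linarith) hαn hq0.le hγ hum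
    hfix hint
  have hus : MemLp u (ENNReal.ofReal (γ + q)) σ :=
    (memLp_ofReal_iff (by linarith)).2 ⟨hum.aestronglyMeasurable, hint.lt_top⟩
  exact ⟨u, ⟨memLpLoc_of_memLp (by linarith) hus, fun x => (congrFun hfix x).symm⟩, hpos,
    (memLp_ofReal_iff (by positivity)).2 ⟨hum.aestronglyMeasurable, hur.lt_top⟩⟩

end Existence

section Nonexistence

theorem lintegral_norm_add_rpow_neg_eq_top {E : Type*} [NormedAddCommGroup E] [NormedSpace ℝ E]
    [Nontrivial E] [FiniteDimensional ℝ E] [MeasurableSpace E] [BorelSpace E] (μ : Measure E)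
    [μ.IsAddHaarMeasure] {R a : ℝ} (hR : 0 < R) (ha : a ≤ Module.finrank ℝ E) :
    ∫⁻ x, ENNReal.ofReal ((‖x‖ + R) ^ (-a)) ∂μ = ∞ := by
  by_contra hfin
  set d := Module.finrank ℝ E with hd
  have hd0 : d ≠ 0 := Module.finrank_pos.ne'
  have hpos (x : E) : 0 < ‖x‖ + R := add_pos_of_nonneg_of_pos (norm_nonneg x) hR
  have hcont : Continuous fun x : E => (‖x‖ + R) ^ (-a) :=
    (continuous_norm.add continuous_const).rpow_const fun x => Or.inl (hpos x).ne'
  have hint : Integrable (fun x : E => (‖x‖ + R) ^ (-a)) μ :=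
    ⟨hcont.aestronglyMeasurable, (hasFiniteIntegral_iff_ofReal (Eventually.of_forall fun x =>
      Real.rpow_nonneg (hpos x).le _)).2 (lt_top_iff_ne_top.2 hfin)⟩
  rw [integrable_fun_norm_addHaar μ (f := fun y : ℝ => (y + R) ^ (-a)), ← hd] at hint
  have htail := hint.mono_set (Set.Ioi_subset_Ioi (show 0 ≤ R + 1 by positivity))
  refine not_integrableOn_Ioi_inv (a := R + 1) <|
    Integrable.mono' (htail.const_mul (2 ^ d)) (by fun_prop) ?_
  filter_upwards [ae_restrict_mem measurableSet_Ioi] with y (hy : R + 1 < y)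
  have hy0 : 0 < y := by linarith
  have hpow : (2 * y) ^ (-(d : ℝ)) ≤ (y + R) ^ (-a) :=
    calc (2 * y) ^ (-(d : ℝ)) ≤ (y + R) ^ (-(d : ℝ)) :=
          Real.rpow_le_rpow_of_nonpos (by linarith) (by linarith) (by simp)
      _ ≤ _ := Real.rpow_le_rpow_of_exponent_le (by linarith) (by linarith)
  calc ‖y⁻¹‖ = 2 ^ d * (y ^ (d - 1) * (2 * y) ^ (-(d : ℝ))) := by
        rw [Real.norm_of_nonneg (by positivity), Real.rpow_neg (by positivity),
          Real.rpow_natCast, mul_pow, ← pow_sub_one_mul hd0 y]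
        field_simp
    _ ≤ 2 ^ d * (y ^ (d - 1) • (y + R) ^ (-a)) := by rw [smul_eq_mul]; gcongr

variable {n : ℕ} {β r : ℝ} {ω : Measure (EuclideanSpace ℝ (Fin n))}

theorem ofReal_norm_add_rpow_mul_measure_closedBall_le (hβ : β ≤ n) {R : ℝ} (hR : 0 < R)
    (x : EuclideanSpace ℝ (Fin n)) :
    ENNReal.ofReal ((‖x‖ + R) ^ (β - n)) * ω (Metric.closedBall 0 R) ≤ rieszPotential β ω x :=
  calc _ ≤ ENNReal.ofReal (‖x‖ + R) ^ (β - n) * ω (Metric.closedBall x (‖x‖ + R)) := by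
        rw [ENNReal.ofReal_rpow_of_pos (by positivity)]
        gcongr
        exact Metric.closedBall_subset_closedBall' (by rw [dist_zero_left, add_comm])
    _ ≤ rieszPotential β ω x := edist_rpow_mul_measure_closedBall_le hβ x _

/-- At infinity `I_β ω` is at least a multiple of `|x|^(β - n)`, whose `r`-th power is not
integrable. -/
theorem lintegral_rieszPotential_rpow_eq_top (hβ : β < n) (hr0 : 0 < r) (hr : r ≤ n / (n - β))
    (hω : ω ≠ 0) : ∫⁻ x, rieszPotential β ω x ^ r = ∞ := by
  have hnβ : 0 < n - β := by linarith
  have hrn : (n - β) * r ≤ n := by rwa [le_div_iff₀' hnβ] at hr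
  have hn : 0 < n := by exact_mod_cast (mul_pos hnβ hr0).trans_le hrn
  have : Nonempty (Fin n) := ⟨⟨0, hn⟩⟩
  obtain ⟨R, hR, hωR⟩ : ∃ R : ℝ, 0 < R ∧ ω (Metric.closedBall 0 R) ≠ 0 := by
    by_contra! hball
    refine hω (Measure.measure_univ_eq_zero.1 ?_)
    rw [← Metric.iUnion_closedBall_nat 0]
    exact measure_iUnion_null fun k => measure_mono_null
      (Metric.closedBall_subset_closedBall (by linarith)) (hball (k + 1) (by positivity))
  set m := ω (Metric.closedBall 0 R)
  have hm : m ^ r ≠ 0 := by simp [ENNReal.rpow_eq_zero_iff_of_pos hr0, hωR]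
  refine top_le_iff.1 ?_
  calc ∞ = (∫⁻ x : EuclideanSpace ℝ (Fin n),
        ENNReal.ofReal ((‖x‖ + R) ^ (-((n - β) * r)))) * m ^ r := by
        rw [lintegral_norm_add_rpow_neg_eq_top volume hR (by simpa using hrn), ENNReal.top_mul hm]
    _ = ∫⁻ x : EuclideanSpace ℝ (Fin n), (ENNReal.ofReal ((‖x‖ + R) ^ (β - n)) * m) ^ r := by
        rw [← lintegral_mul_const _ (by fun_prop)]
        refine lintegral_congr fun x => ?_
        rw [ENNReal.mul_rpow_of_nonneg _ _ hr0.le, ENNReal.ofReal_rpow_of_pos (by positivity),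
          ← Real.rpow_mul (by positivity), ← neg_mul, neg_sub]
    _ ≤ ∫⁻ x, rieszPotential β ω x ^ r := lintegral_mono fun x => ENNReal.rpow_le_rpow
        (ofReal_norm_add_rpow_mul_measure_closedBall_le hβ.le hR x) hr0.le

theorem eq_zero_of_rieszPotential_le_of_memLp (hβ : β < n) (hr0 : 0 < r) (hr : r ≤ n / (n - β))
    {u : EuclideanSpace ℝ (Fin n) → ℝ≥0∞} (hu : MemLp u (ENNReal.ofReal r) volume)
    (hle : ∀ x, rieszPotential β ω x ≤ u x) : ω = 0 := by
  by_contra hω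
  refine ((memLp_ofReal_iff hr0).1 hu).2.not_ge ?_
  rw [← lintegral_rieszPotential_rpow_eq_top hβ hr0 hr hω]
  exact lintegral_mono fun x => ENNReal.rpow_le_rpow (hle x) hr0.le

theorem eq_zero_of_eq_rieszPotential_of_memLp (hβ : β < n) (hr0 : 0 < r) (hr : r ≤ n / (n - β))
    {u : EuclideanSpace ℝ (Fin n) → ℝ≥0∞} (hu : MemLp u (ENNReal.ofReal r) volume)
    (heq : ∀ x, u x = rieszPotential β ω x) (x : EuclideanSpace ℝ (Fin n)) : u x = 0 := by
  rw [heq, eq_zero_of_rieszPotential_le_of_memLp hβ hr0 hr hu fun x => (heq x).ge,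
    rieszPotential_zero, Pi.zero_apply]

theorem MemLpLoc.aemeasurable {q : ℝ} {σ : Measure (EuclideanSpace ℝ (Fin n))}
    {u : EuclideanSpace ℝ (Fin n) → ℝ≥0∞} (h : MemLpLoc u q σ) : AEMeasurable u σ := by
  rw [← Measure.restrict_univ (μ := σ), ← Metric.iUnion_closedBall_nat 0, aemeasurable_iUnion_iff]
  exact fun k => (h _ (isCompact_closedBall 0 k)).1.aemeasurable

theorem IsSupersolution.ae_eq_zero {α q : ℝ} {σ : Measure (EuclideanSpace ℝ (Fin n))}
    (hαn : 2 * α < n) (hq : 0 < q) (hr0 : 0 < r) (hr : r ≤ n / (n - 2 * α))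
    {u : EuclideanSpace ℝ (Fin n) → ℝ≥0∞} (hu : MemLp u (ENNReal.ofReal r) volume)
    (hsol : IsSupersolution α q σ u) : u =ᵐ[σ] 0 := by
  have hzero := eq_zero_of_rieszPotential_le_of_memLp hαn hr0 hr hu hsol.potential_le
  rw [powMeasure, withDensity_eq_zero_iff (hsol.memLpLoc.aemeasurable.pow_const q)] at hzero
  filter_upwards [hzero] with x hx
  exact (ENNReal.rpow_eq_zero_iff_of_pos hq).1 hx

end Nonexistence

theorem theorem1p4_general (n : ℕ) (q α r : ℝ) (hq0 : 0 < q) (hαn : α < (n : ℝ) / 2) (hr : 0 < r)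
    (σ : Measure (EuclideanSpace ℝ (Fin n))) :
    (q < 1 → 0 < α → σ ≠ 0 → (n : ℝ) / (n - 2 * α) < r →
      ∀ γ : ℝ, γ = (r * (n - 2 * α) - n) / n →
      MemLp (rieszPotential (2 * α) σ) (ENNReal.ofReal ((γ + q) / (1 - q))) σ →
      ∃ u : EuclideanSpace ℝ (Fin n) → ℝ≥0∞,
        IsSolution α q σ u ∧ (∀ x, 0 < u x) ∧
        MemLp u (ENNReal.ofReal r) volume ∧
        liminf u (cocompact (EuclideanSpace ℝ (Fin n))) = 0) ∧
    (r ≤ (n : ℝ) / (n - 2 * α) →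
      ∀ u : EuclideanSpace ℝ (Fin n) → ℝ≥0∞, MemLp u (ENNReal.ofReal r) volume →
        (IsSupersolution α q σ u → u =ᵐ[σ] 0) ∧
        (IsPotentialSupersolution α q σ u → ∀ x, u x = 0) ∧
        (IsSolution α q σ u → ∀ x, u x = 0)) := by
  have hβ : 2 * α < n := by linarith
  have hnα : 0 < n - 2 * α := by linarith
  refine ⟨fun hq1 hα0 hσ hrn γ hγ hK => ?_, fun hrn u hu => ⟨?_, fun hsol => ?_, fun hsol => ?_⟩⟩
  · have hn : (0 : ℝ) < n := by linarith
    have hγ0 : 0 < γ := hγ ▸ div_pos (sub_pos.2 ((div_lt_iff₀ hnα).1 hrn)) hn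
    have hrγ : (1 + γ) * (n / (n - 2 * α)) = r := by rw [hγ]; field_simp; ring
    obtain ⟨u, hsol, hpos, hu⟩ := exists_isSolution_pos_memLp hα0 hβ hq0 hq1 hγ0 hσ hK
    rw [hrγ] at hu
    have : Nonempty (Fin n) := ⟨⟨0, by exact_mod_cast hn⟩⟩
    exact ⟨u, hsol, hpos, hu, liminf_cocompact_eq_zero_of_memLp
      (measure_univ_of_isAddLeftInvariant _) (by simpa using hr) ENNReal.ofReal_ne_top hu⟩
  · exact IsSupersolution.ae_eq_zero hβ hq0 hr hrn hu
  · obtain ⟨ω, -, -, heq⟩ := hsol.exists_measure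
    exact eq_zero_of_eq_rieszPotential_of_memLp hβ hr hrn hu heq
  · exact eq_zero_of_eq_rieszPotential_of_memLp hβ hr hrn hu hsol.eq_potential

theorem theorem1p4 (n : ℕ) (q α r : ℝ) (hq0 : 0 < q) (hq1 : q < 1)
    (hα0 : 0 < α) (hαn : α < (n : ℝ) / 2) (hr : 0 < r)
    (σ : Measure (EuclideanSpace ℝ (Fin n))) [IsLocallyFiniteMeasure σ] (hσ : σ ≠ 0) :
    ((n : ℝ) / (n - 2 * α) < r →
      ∀ γ : ℝ, γ = (r * (n - 2 * α) - n) / n →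
      MemLp (rieszPotential (2 * α) σ) (ENNReal.ofReal ((γ + q) / (1 - q))) σ →
      ∃ u : EuclideanSpace ℝ (Fin n) → ℝ≥0∞,
        IsSolution α q σ u ∧ (∀ x, 0 < u x) ∧
        MemLp u (ENNReal.ofReal r) volume ∧
        liminf u (cocompact (EuclideanSpace ℝ (Fin n))) = 0) ∧
    (r ≤ (n : ℝ) / (n - 2 * α) →
      ∀ u : EuclideanSpace ℝ (Fin n) → ℝ≥0∞, MemLp u (ENNReal.ofReal r) volume →
        (IsSupersolution α q σ u → u =ᵐ[σ] 0) ∧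
        (IsPotentialSupersolution α q σ u → ∀ x, u x = 0) ∧
        (IsSolution α q σ u → ∀ x, u x = 0)) :=
  have ⟨existence, liouville⟩ := theorem1p4_general n q α r hq0 hαn hr σ
  ⟨existence hq1 hα0 hσ, liouville⟩
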